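/- A \emph{dimaze} $(D,B_0)$ is a (possibly infinite) digraph $D$ without loops or parallel edges together with a set $B_0\subseteq V(D)$ of sinks, called the exits. A set $A\subseteq V(D)$ is \emph{linkable} if there is a set of pairwise vertex-disjoint finite directed paths of $D$ (trivial paths allowed), each ending in $B_0$, whose set of initial vertices is $A$. Let $M_L(D,B_0)$ denote the pair consisting of $V(D)$ and the family of linkable sets. Matroids are allowed to be infinite (in the sense of Bruhn, Diestel, Kriesell, Pendavingh and Wollan). A \emph{strict gammoid} is a matroid isomorphic to $M_L(D,B_0)$ for some dimaze $(D,B_0)$, and a \emph{gammoid} is a matroid that is, up to isomorphism, a restriction of a strict gammoid. **Theorem.** Let $M$ be a (possibly infinite) gammoid, and let $N = M/C\setminus R$ be a minor of $M$ of finite rank. Then $N$ is a gammoid. -/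

import Mathlib

universe u v

namespace InfGammoid

/-- A finite directed path of a digraph: a nonempty sequence of distinct vertices, consecutive
ones being joined by an edge. A single vertex is a (trivial) path. -/
structure Dipath {V : Type v} (D : Digraph V) where
  verts : List V
  ne_nil : verts ≠ []
  isChain : verts.IsChain D.Adj
  nodup : verts.Nodup

namespace Dipath

/-- The initial vertex of a path. -/
def ini {V : Type v} {D : Digraph V} (P : Dipath D) : V := P.verts.head P.ne_nil

/-- The terminal vertex of a path. -/
def ter {V : Type v} {D : Digraph V} (P : Dipath D) : V := P.verts.getLast P.ne_nil

end Dipath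

/-- A dimaze with vertex set `V`: a loopless digraph (without parallel edges, possibly infinite)
together with a set of sinks, called the exits. -/
structure Dimaze (V : Type v) extends Digraph V where
  loopless : ∀ v, ¬ Adj v v
  exits : Set V
  exits_sink : ∀ b ∈ exits, ∀ v, ¬ Adj b v

namespace Dimaze

/-- A linkage: a set of pairwise vertex-disjoint finite paths, each ending in an exit. -/
def IsLinkage {V : Type v} (D : Dimaze V) (P : Set (Dipath D.toDigraph)) : Prop :=
  (∀ p ∈ P, p.ter ∈ D.exits) ∧ P.Pairwise (fun p q => List.Disjoint p.verts q.verts)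

/-- A set of vertices is linkable if it is the set of initial vertices of a linkage. -/
def Linkable {V : Type v} (D : Dimaze V) (A : Set V) : Prop :=
  ∃ P : Set (Dipath D.toDigraph), D.IsLinkage P ∧ Dipath.ini '' P = A

/-- The matroid `M` is the linkability system of the dimaze `D`: the ground set is the whole
vertex set and the independent sets are the linkable sets. (Not every dimaze admits such an `M`,
since the linkability system of an infinite dimaze need not be a matroid.) -/
def IsLinkabilityMatroid {V : Type v} (D : Dimaze V) (M : Matroid V) : Prop :=
  M.E = Set.univ ∧ ∀ I : Set V, M.Indep I ↔ D.Linkable I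

end Dimaze

/-- Isomorphism of matroids: a bijection of the ground sets that preserves independence in
both directions. -/
def IsIsomorphic {α : Type u} {β : Type v} (M : Matroid α) (N : Matroid β) : Prop :=
  ∃ e : M.E ≃ N.E, ∀ I : Set M.E,
    M.Indep (Subtype.val '' I) ↔ N.Indep (Subtype.val '' (e '' I))

/-- A strict gammoid: a matroid isomorphic to the linkability system of some dimaze. -/
def IsStrictGammoid {β : Type v} (M : Matroid β) : Prop :=
  ∃ (V : Type v) (D : Dimaze V) (L : Matroid V), D.IsLinkabilityMatroid L ∧ IsIsomorphic M L

/-- A gammoid: a matroid that is (isomorphic to) a restriction of a strict gammoid. The strict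
gammoid may live on another type, as it may need elements that the type `α` does not have;
its universe is arbitrary. -/
def IsGammoid {α : Type u} (M : Matroid α) : Prop :=
  ∃ (β : Type v) (N : Matroid β), IsStrictGammoid N ∧
    ∃ X : Set β, X ⊆ N.E ∧ IsIsomorphic M (N.restrict X)

end InfGammoid

/-! A linkage is encoded as a router: a self-map moving each vertex along an edge or not at all,
injective off the exits and without infinite orbits. A set is linkable iff it lies in the `free` set
of some router. Off the exits, a router is a matching of each vertex to itself or an out-neighbour,
and `free` is the unmatched set. Presenting the same matching problem relative to another router `m`
is a change of base: it gives the dimaze `shift`.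

Write `N = M/C\R`, let `S` be a basis of `C` in `M`, and let `B` be a base of `N`, which is finite.
Inside a dimaze `D` for `M`, a set `I` is independent in `N` iff `S ∪ I` is linkable. Shift `D`
along a router linking `S ∪ B`, with exits `B` and entry to `S` forbidden. Composing routers turns
linkages of the shift into linkages in `D` together with `S`. Conversely, if a linkage could not be
augmented in the shift, a separating set `U` would let two routers be spliced into a linkage too
large for the rank of `N`.

Finiteness of `B` is used throughout: it makes the relevant routers have finite support, so
composition creates no rays; it makes the cardinality comparisons strict; and it makes the
linkability system of the new dimaze a matroid. -/

namespace InfGammoid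

open Set

universe w

/-! ### Self-maps with finite orbits. -/

section Orbits

variable {V : Type w}

/-- Every forward orbit of `m` is finite. -/
def FiniteOrbits (m : V → V) : Prop := ∀ v, (range fun n : ℕ => m^[n] v).Finite

theorem finite_orbit_of_finite_orbit_iterate {m : V → V} {v : V} (k : ℕ)
    (h : (range fun n : ℕ => m^[n] (m^[k] v)).Finite) :
    (range fun n : ℕ => m^[n] v).Finite := by
  refine (h.union ((finite_lt_nat k).image fun n => m^[n] v)).subset ?_
  rintro _ ⟨n, rfl⟩
  rcases lt_or_ge n k with hn | hn
  · exact Or.inr ⟨n, hn, rfl⟩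
  · refine Or.inl ⟨n - k, ?_⟩
    simp only [← Function.iterate_add_apply]
    congr 2
    omega

theorem finite_orbit_of_mapsTo {m : V → V} {v : V} {s : Set V} (hs : s.Finite) (hv : v ∈ s)
    (h : MapsTo m s s) : (range fun n : ℕ => m^[n] v).Finite := by
  refine hs.subset ?_
  rintro _ ⟨n, rfl⟩
  exact h.iterate n hv

theorem iterate_injective_of_infinite_orbit {m : V → V} {v : V}
    (h : ¬ (range fun n : ℕ => m^[n] v).Finite) : Function.Injective fun n : ℕ => m^[n] v := by
  have key : ∀ i j : ℕ, i < j → m^[i] v ≠ m^[j] v := by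
    intro i j hij heq
    refine h (((finite_lt_nat j).image fun n => m^[n] v).subset ?_)
    rintro _ ⟨n, rfl⟩
    induction n with
    | zero => exact ⟨0, by simp only [mem_ofPred_eq]; omega, rfl⟩
    | succ n ih =>
      obtain ⟨l, hl, hl'⟩ := ih
      simp only [mem_ofPred_eq] at hl hl'
      have h1 : m^[l + 1] v = m^[n + 1] v := by
        rw [Function.iterate_succ_apply', Function.iterate_succ_apply', hl']
      rcases Nat.lt_or_ge (l + 1) j with h2 | h2
      · exact ⟨l + 1, h2, h1⟩
      · have : l + 1 = j := by omega
        subst this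
        exact ⟨i, hij, heq.trans h1⟩
  intro i j hij
  by_contra hne
  rcases Nat.lt_or_gt_of_ne hne with h1 | h1
  · exact key _ _ h1 hij
  · exact key _ _ h1 hij.symm

/-- Changing a map at finitely many places keeps its orbits finite. -/
theorem FiniteOrbits.of_finite_ne {m n : V → V} (hm : FiniteOrbits m)
    (h : {v | n v ≠ m v}.Finite) : FiniteOrbits n := by
  intro v
  by_contra hv
  have hinj := iterate_injective_of_infinite_orbit hv
  -- An infinite orbit never repeats, so it meets the changed places finitely often; beyond the last
  -- visit it is an orbit of `m`.
  have hfin : {k : ℕ | n^[k] v ∈ {v | n v ≠ m v}}.Finite := h.preimage hinj.injOn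
  obtain ⟨K, hK⟩ := hfin.bddAbove
  have hagree : ∀ i, n^[i] (n^[K + 1] v) = m^[i] (n^[K + 1] v) := by
    intro i
    induction i with
    | zero => rfl
    | succ i ih =>
      rw [Function.iterate_succ_apply' n i, Function.iterate_succ_apply' m i, ← ih]
      by_contra hne
      have h1 : i + (K + 1) ≤ K := hK (by
        simp only [mem_ofPred_eq, Function.iterate_add_apply n i (K + 1)]; exact hne)
      omega
  refine hv (finite_orbit_of_finite_orbit_iterate (K + 1) ?_)
  simp only [hagree]
  exact hm _

theorem finiteOrbits_of_finite_support {m : V → V} (h : {v | m v ≠ v}.Finite) :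
    FiniteOrbits m := by
  refine FiniteOrbits.of_finite_ne (m := id) (fun v => ?_) h
  refine finite_orbit_of_mapsTo (finite_singleton v) rfl ?_
  intro x hx; exact hx

end Orbits

/-! ### Linkages and routers. -/

namespace Dimaze

variable {V : Type w}

theorem Linkable.subset {D : Dimaze V} {A A' : Set V} (h : D.Linkable A) (hA : A' ⊆ A) :
    D.Linkable A' := by
  obtain ⟨P, ⟨hP, hd⟩, rfl⟩ := h
  refine ⟨{p ∈ P | p.ini ∈ A'}, ⟨fun p hp => hP p hp.1, hd.mono fun p hp => hp.1⟩, ?_⟩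
  ext a
  constructor
  · rintro ⟨p, hp, rfl⟩; exact hp.2
  · intro ha
    obtain ⟨p, hp, rfl⟩ := hA ha
    exact ⟨p, ⟨hp, ha⟩, rfl⟩

theorem linkable_empty (D : Dimaze V) : D.Linkable ∅ :=
  ⟨∅, ⟨by simp, by simp⟩, by simp⟩

theorem Linkable.encard_le {D : Dimaze V} {A : Set V} (h : D.Linkable A) :
    A.encard ≤ D.exits.encard := by
  obtain ⟨P, ⟨hP, hd⟩, rfl⟩ := h
  have hinj : InjOn Dipath.ter P := by
    intro p hp q hq hpq
    by_contra hne
    exact hd hp hq hne (List.getLast_mem p.ne_nil)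
      (by change p.ter ∈ _; rw [hpq]; exact List.getLast_mem q.ne_nil)
  calc (Dipath.ini '' P).encard ≤ P.encard := encard_image_le _ _
    _ = (Dipath.ter '' P).encard := hinj.encard_image.symm
    _ ≤ D.exits.encard := encard_le_encard (by rintro _ ⟨p, hp, rfl⟩; exact hP p hp)

/-- A linkage in functional form: every vertex on a path is sent to its successor, and every
vertex off the paths to itself. Cycles and paths with a free start are allowed, but no rays. -/
structure IsRouter (D : Dimaze V) (m : V → V) : Prop where
  injOn : InjOn m D.exitsᶜ
  adj : ∀ v, m v = v ∨ D.Adj v (m v)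
  finiteOrbits : FiniteOrbits m

/-- The vertices without predecessor under a router. -/
def free (D : Dimaze V) (m : V → V) : Set V := (m '' D.exitsᶜ)ᶜ

theorem IsRouter.apply_exit {D : Dimaze V} {m : V → V} (hm : D.IsRouter m) {b : V}
    (hb : b ∈ D.exits) : m b = b :=
  (hm.adj b).resolve_right (D.exits_sink b hb _)

theorem apply_notMem_of_subset_free {D : Dimaze V} {m : V → V} {S : Set V}
    (hS : S ⊆ D.free m) {v : V} (hv : v ∉ D.exits) : m v ∉ S :=
  fun h => hS h ⟨v, hv, rfl⟩

theorem mem_free {D : Dimaze V} {m : V → V} {w : V} :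
    w ∈ D.free m ↔ ∀ v, v ∉ D.exits → m v ≠ w := by
  simp [free]

/-- Injectivity cancels one step at a time from both orbits, and a free vertex has no predecessor,
so both run out together. Hence orbits from free vertices, up to their exits, are disjoint paths. -/
theorem IsRouter.iterate_cancel {D : Dimaze V} {m : V → V} (hm : D.IsRouter m) {a a' : V}
    (ha : a ∈ D.free m) (ha' : a' ∈ D.free m) :
    ∀ i j : ℕ, (∀ k < i, m^[k] a ∉ D.exits) → (∀ k < j, m^[k] a' ∉ D.exits) →
      m^[i] a = m^[j] a' → i = j ∧ a = a' := by
  intro i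
  induction i with
  | zero =>
    intro j _ hj h
    cases j with
    | zero => exact ⟨rfl, h⟩
    | succ j =>
      rw [Function.iterate_succ_apply'] at h
      exact absurd h.symm (mem_free.1 ha _ (hj j (Nat.lt_succ_self j)))
  | succ i ih =>
    intro j hi hj h
    cases j with
    | zero =>
      rw [Function.iterate_succ_apply'] at h
      exact absurd h (mem_free.1 ha' _ (hi i (Nat.lt_succ_self i)))
    | succ j =>
      rw [Function.iterate_succ_apply', Function.iterate_succ_apply'] at h
      have h' := hm.injOn (hi i (Nat.lt_succ_self i)) (hj j (Nat.lt_succ_self j)) h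
      obtain ⟨h1, h2⟩ := ih j (fun k hk => hi k (hk.trans (Nat.lt_succ_self i)))
        (fun k hk => hj k (hk.trans (Nat.lt_succ_self j))) h'
      exact ⟨congrArg _ h1, h2⟩

theorem IsRouter.exists_iterate_mem_exits {D : Dimaze V} {m : V → V} (hm : D.IsRouter m) {a : V}
    (ha : a ∈ D.free m) : ∃ n, m^[n] a ∈ D.exits := by
  by_contra! h
  refine infinite_range_of_injective (f := fun n : ℕ => m^[n] a) ?_ (hm.finiteOrbits a)
  intro i j hij
  exact (hm.iterate_cancel ha ha i j (fun k _ => h k) (fun k _ => h k) hij).1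

theorem IsRouter.linkable {D : Dimaze V} {m : V → V} (hm : D.IsRouter m) {A : Set V}
    (hA : A ⊆ D.free m) : D.Linkable A := by
  classical
  have hex : ∀ a : A, ∃ n, m^[n] (a : V) ∈ D.exits := fun a =>
    hm.exists_iterate_mem_exits (hA a.2)
  let N : A → ℕ := fun a => Nat.find (hex a)
  have hN : ∀ a : A, m^[N a] (a : V) ∈ D.exits := fun a => Nat.find_spec (hex a)
  have hlt : ∀ a : A, ∀ k < N a, m^[k] (a : V) ∉ D.exits := fun a k hk => Nat.find_min (hex a) hk
  have hcan : ∀ a a' : A, ∀ i j : ℕ, i ≤ N a → j ≤ N a' → m^[i] (a : V) = m^[j] (a' : V) →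
      i = j ∧ a = a' := by
    intro a a' i j hi hj h
    obtain ⟨h1, h2⟩ := hm.iterate_cancel (hA a.2) (hA a'.2) i j
      (fun k hk => hlt a k (hk.trans_le hi)) (fun k hk => hlt a' k (hk.trans_le hj)) h
    exact ⟨h1, Subtype.ext h2⟩
  let p : A → Dipath D.toDigraph := fun a =>
    { verts := List.ofFn fun i : Fin (N a + 1) => m^[i] (a : V)
      ne_nil := by simp
      isChain := by
        rw [List.isChain_iff_getElem]
        intro i hi
        simp only [List.length_ofFn] at hi
        simp only [List.getElem_ofFn, Function.iterate_succ_apply']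
        refine (hm.adj _).resolve_left fun h => ?_
        rw [← Function.iterate_succ_apply' m] at h
        have := (hcan a a _ _ (by omega) (by omega) h).1
        omega
      nodup := by
        rw [List.nodup_ofFn]
        intro i j h
        exact Fin.ext (hcan a a _ _ (by omega) (by omega) h).1 }
  have hini : ∀ a, (p a).ini = a := by
    intro a
    simp only [Dipath.ini, p, List.head_ofFn]
    rfl
  have hter : ∀ a, (p a).ter = m^[N a] (a : V) := by
    intro a
    simp only [Dipath.ter, p, List.getLast_ofFn]
    rfl
  refine ⟨range p, ⟨?_, ?_⟩, ?_⟩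
  · rintro _ ⟨a, rfl⟩
    rw [hter]; exact hN a
  · rintro _ ⟨a, rfl⟩ _ ⟨a', rfl⟩ hne x hx hx'
    simp only [p, List.mem_ofFn] at hx hx'
    obtain ⟨i, rfl⟩ := hx
    obtain ⟨j, hj⟩ := hx'
    exact hne (by rw [(hcan a a' _ _ (by omega) (by omega) hj.symm).2])
  · ext x
    constructor
    · rintro ⟨_, ⟨a, rfl⟩, rfl⟩
      rw [hini]; exact a.2
    · intro hx
      exact ⟨_, ⟨⟨x, hx⟩, rfl⟩, hini _⟩

/-- The linkage-to-router translation. -/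
theorem Linkable.exists_isRouter {D : Dimaze V} {A : Set V} (h : D.Linkable A) :
    ∃ m, D.IsRouter m ∧ A ⊆ D.free m ∧ D.free m ⊆ A ∪ D.exits ∧
      (A.Finite → {v | m v ≠ v}.Finite) := by
  classical
  obtain ⟨P, ⟨hter, hdis⟩, rfl⟩ := h
  have huniq : ∀ {p q : Dipath D.toDigraph}, p ∈ P → q ∈ P → ∀ {x}, x ∈ p.verts → x ∈ q.verts →
      p = q := by
    intro p q hp hq x hxp hxq
    by_contra hne
    exact hdis hp hq hne hxp hxq
  have hidx : ∀ {p q : Dipath D.toDigraph}, p ∈ P → q ∈ P → ∀ {i j : ℕ}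
      (hi : i < p.verts.length) (hj : j < q.verts.length), p.verts[i] = q.verts[j] →
      p = q ∧ i = j := by
    intro p q hp hq i j hi hj h
    obtain rfl := huniq hp hq (List.getElem_mem hi) (h ▸ List.getElem_mem hj)
    exact ⟨rfl, (List.Nodup.getElem_inj_iff p.nodup).1 h⟩
  let R : V → V → Prop := fun v w => ∃ p ∈ P, ∃ (i : ℕ) (hi : i + 1 < p.verts.length),
    p.verts[i] = v ∧ p.verts[i + 1] = w
  have hRfun : ∀ {v w w'}, R v w → R v w' → w = w' := by
    rintro v w w' ⟨p, hp, i, hi, rfl, rfl⟩ ⟨q, hq, j, hj, h, rfl⟩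
    obtain ⟨rfl, rfl⟩ := hidx hq hp _ _ h
    rfl
  have hRinj : ∀ {v v' w}, R v w → R v' w → v = v' := by
    rintro v v' w ⟨p, hp, i, hi, rfl, rfl⟩ ⟨q, hq, j, hj, rfl, h⟩
    obtain ⟨rfl, h⟩ := hidx hq hp _ _ h
    obtain rfl : j = i := by omega
    rfl
  have hRadj : ∀ {v w}, R v w → D.Adj v w := by
    rintro v w ⟨p, hp, i, hi, rfl, rfl⟩
    exact List.isChain_iff_getElem.1 p.isChain i hi
  have hRlast : ∀ {p}, p ∈ P → ∀ {x}, x ∈ p.verts → x ∉ D.exits → ∃ w, R x w := by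
    intro p hp x hx hxe
    obtain ⟨i, hi, rfl⟩ := List.getElem_of_mem hx
    by_cases h : i + 1 < p.verts.length
    · exact ⟨_, p, hp, i, h, rfl, rfl⟩
    · refine absurd (hter p hp) ?_
      rw [Dipath.ter, List.getLast_eq_getElem]
      convert hxe using 3
      simp only [show p.verts.length - 1 = i by omega]
  let m : V → V := fun v => if h : ∃ w, R v w then h.choose else v
  have hmR : ∀ {v w}, R v w → m v = w := by
    intro v w h
    have hex : ∃ w, R v w := ⟨w, h⟩
    simp only [m, dif_pos hex]
    exact hRfun hex.choose_spec h
  have hmn : ∀ {v}, (¬ ∃ w, R v w) → m v = v := by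
    intro v h
    simp only [m, dif_neg h]
  have hmaps : ∀ {p}, p ∈ P → ∀ {x}, x ∈ p.verts → m x ∈ p.verts := by
    intro p hp x hx
    by_cases h : ∃ w, R x w
    · obtain ⟨w, h⟩ := h
      rw [hmR h]
      obtain ⟨q, hq, i, hi, rfl, rfl⟩ := h
      obtain rfl := huniq hp hq hx (List.getElem_mem _)
      exact List.getElem_mem _
    · rwa [hmn h]
  have hRmem : ∀ {v w}, R v w → ∃ p ∈ P, v ∈ p.verts ∧ w ∈ p.verts := by
    rintro v w ⟨p, hp, i, hi, rfl, rfl⟩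
    exact ⟨p, hp, List.getElem_mem _, List.getElem_mem _⟩
  refine ⟨m, ⟨?_, ?_, ?_⟩, ?_, ?_, ?_⟩
  · intro v hv v' hv' h
    by_cases h1 : ∃ w, R v w
    · obtain ⟨w, h1⟩ := h1
      by_cases h2 : ∃ w, R v' w
      · obtain ⟨w', h2⟩ := h2
        rw [hmR h1, hmR h2] at h
        subst h
        exact hRinj h1 h2
      · rw [hmR h1, hmn h2] at h
        subst h
        obtain ⟨p, hp, -, hw⟩ := hRmem h1
        exact absurd (hRlast hp hw hv') h2
    · by_cases h2 : ∃ w, R v' w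
      · obtain ⟨w', h2⟩ := h2
        rw [hmn h1, hmR h2] at h
        subst h
        obtain ⟨p, hp, -, hw⟩ := hRmem h2
        exact absurd (hRlast hp hw hv) h1
      · rwa [hmn h1, hmn h2] at h
  · intro v
    by_cases h : ∃ w, R v w
    · obtain ⟨w, h⟩ := h
      rw [hmR h]; exact Or.inr (hRadj h)
    · exact Or.inl (hmn h)
  · intro v
    by_cases h : ∃ p ∈ P, v ∈ p.verts
    · obtain ⟨p, hp, hv⟩ := h
      exact finite_orbit_of_mapsTo (List.finite_toSet p.verts) hv fun x hx => hmaps hp hx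
    · refine finite_orbit_of_mapsTo (finite_singleton v) rfl ?_
      rintro x rfl
      refine hmn ?_
      rintro ⟨w, hw⟩
      obtain ⟨p, hp, h1, -⟩ := hRmem hw
      exact h ⟨p, hp, h1⟩
  · rintro _ ⟨p, hp, rfl⟩
    have h0 : p.ini = p.verts[0]'(List.length_pos_of_ne_nil p.ne_nil) :=
      (List.head_eq_getElem p.ne_nil)
    rw [mem_free]
    intro v hv h
    by_cases h1 : ∃ w, R v w
    · obtain ⟨w, h1⟩ := h1
      rw [hmR h1] at h
      obtain ⟨q, hq, i, hi, rfl, rfl⟩ := h1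
      rw [h0] at h
      have := (hidx hq hp _ _ h).2
      omega
    · rw [hmn h1] at h
      subst h
      exact h1 (hRlast hp (List.head_mem p.ne_nil) hv)
  · intro w hw
    rw [mem_free] at hw
    by_cases hwe : w ∈ D.exits
    · exact Or.inr hwe
    by_cases h1 : ∃ u, R w u
    · obtain ⟨u, p, hp, i, hi, rfl, rfl⟩ := h1
      cases i with
      | zero =>
        refine Or.inl ⟨p, hp, ?_⟩
        exact List.head_eq_getElem p.ne_nil
      | succ i =>
        have hR : R p.verts[i] p.verts[i + 1] := ⟨p, hp, i, by omega, rfl, rfl⟩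
        exact absurd (hmR hR) (hw _ fun h => D.exits_sink _ h _ (hRadj hR))
    · exact absurd (hmn h1) (hw w hwe)
  · intro hfin
    have hPfin : P.Finite := by
      refine Finite.of_finite_image hfin ?_
      intro p hp q hq h
      exact huniq hp hq (List.head_mem p.ne_nil)
        (by change p.ini ∈ _; rw [h]; exact List.head_mem q.ne_nil)
    refine (hPfin.biUnion fun p _ => List.finite_toSet p.verts).subset ?_
    intro v hv
    by_cases h1 : ∃ w, R v w
    · obtain ⟨w, h1⟩ := h1
      obtain ⟨p, hp, h1, -⟩ := hRmem h1
      exact mem_biUnion hp h1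
    · exact absurd (hmn h1) hv

/-- Following one router inside a set that cannot be re-entered, another one outside. -/
theorem IsRouter.linkable_combine {D : Dimaze V} {m k : V → V} (hm : D.IsRouter m)
    (hk : D.IsRouter k) {U : Set V}
    (hU : ∀ v, v ∉ D.exits → m v ∈ U → v ∈ U ∧ ∀ u, D.Adj v u → u ∈ U) :
    D.Linkable ((U ∩ D.free k) ∪ (D.free m \ U)) := by
  classical
  let T : Set V := {v | v ∈ U ∧ ∀ u, D.Adj v u → u ∈ U}
  let n : V → V := fun v => if v ∈ T then k v else m v
  have hnT : ∀ {v}, v ∈ T → n v = k v := fun h => if_pos h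
  have hnT' : ∀ {v}, v ∉ T → n v = m v := fun h => if_neg h
  have hkU : ∀ {v}, v ∈ T → k v ∈ U := by
    intro v hv
    rcases hk.adj v with h | h
    · rw [h]; exact hv.1
    · exact hv.2 _ h
  have hmU : ∀ {v}, v ∉ D.exits → v ∉ T → m v ∉ U := fun hv hvT h => hvT (hU _ hv h)
  have hn : D.IsRouter n := by
    refine ⟨?_, ?_, ?_⟩
    · intro v hv v' hv' h
      by_cases h1 : v ∈ T <;> by_cases h2 : v' ∈ T
      · rw [hnT h1, hnT h2] at h; exact hk.injOn hv hv' h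
      · rw [hnT h1, hnT' h2] at h; exact absurd (h ▸ hkU h1) (hmU hv' h2)
      · rw [hnT' h1, hnT h2] at h; exact absurd (h ▸ hkU h2) (hmU hv h1)
      · rw [hnT' h1, hnT' h2] at h; exact hm.injOn hv hv' h
    · intro v
      by_cases h1 : v ∈ T
      · rw [hnT h1]; exact hk.adj v
      · rw [hnT' h1]; exact hm.adj v
    -- An orbit leaving `T` never returns, so every orbit of `n` is either an orbit of `k` or
    -- eventually one of `m`.
    · have hout : ∀ v, v ∉ T → ∀ i : ℕ, n^[i] v = m^[i] v ∧ n^[i] v ∉ T := by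
        intro v hv i
        induction i with
        | zero => exact ⟨rfl, hv⟩
        | succ i ih =>
          obtain ⟨h1, h2⟩ := ih
          rw [Function.iterate_succ_apply', Function.iterate_succ_apply', hnT' h2, ← h1]
          refine ⟨rfl, ?_⟩
          by_cases he : n^[i] v ∈ D.exits
          · rwa [hm.apply_exit he]
          · exact fun h => hmU he h2 h.1
      intro v
      by_cases h : ∃ i : ℕ, n^[i] v ∉ T
      · obtain ⟨i, hi⟩ := h
        refine finite_orbit_of_finite_orbit_iterate i ?_
        simp only [fun j => (hout _ hi j).1]
        exact hm.finiteOrbits _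
      · push Not at h
        have : ∀ i : ℕ, n^[i] v = k^[i] v := by
          intro i
          induction i with
          | zero => rfl
          | succ i ih =>
            rw [Function.iterate_succ_apply', Function.iterate_succ_apply', hnT (h i), ih]
        simp only [this]
        exact hk.finiteOrbits _
  refine hn.linkable ?_
  rintro w (⟨hwU, hw⟩ | ⟨hw, hwU⟩) <;> rw [mem_free] at hw ⊢ <;> intro v hv h <;>
    by_cases h1 : v ∈ T
  · exact hw v hv (by rw [← hnT h1, h])
  · rw [hnT' h1] at h; exact hmU hv h1 (h ▸ hwU)
  · rw [hnT h1] at h; exact hwU (h ▸ hkU h1)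
  · exact hw v hv (by rw [← hnT' h1, h])

/-! ### Shifted dimazes and re-routing. -/

/-- The dimaze obtained by shifting `D` along the router `m`: the vertex `m v` takes over the
role of `v`. The vertices in `S` may no longer be entered, and `B` is the new set of exits. -/
def shift (D : Dimaze V) (m : V → V) (S B : Set V) (hB : B ⊆ D.free m) : Dimaze V where
  Adj w u := ∃ v, v ∉ D.exits ∧ m v = w ∧ (u = v ∨ D.Adj v u) ∧ u ≠ w ∧ u ∉ S
  loopless := by
    rintro v ⟨_, _, _, _, h, _⟩
    exact h rfl
  exits := B
  exits_sink := by
    rintro b hb u ⟨v, hv, h, -⟩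
    exact mem_free.1 (hB hb) v hv h

/-- Re-routing along a router of the shifted dimaze. -/
theorem IsRouter.exists_comp {D : Dimaze V} {m : V → V} (hm : D.IsRouter m) {S B : Set V}
    (hB : B ⊆ D.free m) (hS : S ⊆ D.free m) {t : V → V} (ht : (D.shift m S B hB).IsRouter t)
    (hfin : {v | t v ≠ v}.Finite) :
    ∃ n, D.IsRouter n ∧ (∀ v, v ∉ D.exits → n v = t (m v)) ∧
      S ∪ (D.shift m S B hB).free t ⊆ D.free n := by
  classical
  let n : V → V := fun v => if v ∈ D.exits then v else t (m v)
  have hne : ∀ {v}, v ∈ D.exits → n v = v := fun h => if_pos h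
  have hnn : ∀ {v}, v ∉ D.exits → n v = t (m v) := fun h => if_neg h
  have hmB : ∀ {v}, v ∉ D.exits → m v ∉ B := fun h => apply_notMem_of_subset_free hB h
  -- The maps differ only at preimages under `m` of the finite support of `t`; this rules out new
  -- rays.
  have hdiff : {v | n v ≠ m v}.Finite := by
    have hf : (D.exitsᶜ ∩ m ⁻¹' {v | t v ≠ v}).Finite := by
      refine Finite.of_finite_image (f := m) (hfin.subset ?_) (hm.injOn.mono inter_subset_left)
      rintro _ ⟨v, hv, rfl⟩
      exact hv.2
    refine hf.subset ?_
    intro v hv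
    by_cases he : v ∈ D.exits
    · exact absurd ((hne he).trans (hm.apply_exit he).symm) hv
    · refine ⟨he, ?_⟩
      rw [mem_ofPred_eq, hnn he] at hv
      exact hv
  refine ⟨n, ⟨?_, ?_, hm.finiteOrbits.of_finite_ne hdiff⟩, fun v hv => hnn hv, ?_⟩
  · intro v hv v' hv' h
    rw [hnn hv, hnn hv'] at h
    exact hm.injOn hv hv' (ht.injOn (hmB hv) (hmB hv') h)
  · intro v
    by_cases he : v ∈ D.exits
    · exact Or.inl (hne he)
    rw [hnn he]
    rcases ht.adj (m v) with h | ⟨v', hv', h1, h2, -⟩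
    · rw [h]; exact hm.adj v
    · obtain rfl := hm.injOn hv' he h1
      exact h2
  · rintro w hw
    rw [mem_free]
    intro v hv h
    rw [hnn hv] at h
    rcases hw with hw | hw
    · rcases ht.adj (m v) with h1 | ⟨_, -, -, -, -, h1⟩
      · exact apply_notMem_of_subset_free hS hv (h1 ▸ h ▸ hw)
      · exact h1 (h ▸ hw)
    · exact mem_free.1 hw _ (hmB hv) h

/-! ### Augmenting paths and the matroid property. -/

theorem linkable_singleton_of_reflTransGen (D : Dimaze V) {y b : V}
    (h : Relation.ReflTransGen D.Adj y b) (hb : b ∈ D.exits) : D.Linkable {y} := by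
  suffices hp : ∃ p : Dipath D.toDigraph, p.ini = y ∧ p.ter = b by
    obtain ⟨p, rfl, rfl⟩ := hp
    exact ⟨{p}, ⟨by simpa using hb, pairwise_singleton _ _⟩, by simp⟩
  induction h using Relation.ReflTransGen.head_induction_on with
  | refl => exact ⟨⟨[b], by simp, by simp, by simp⟩, rfl, rfl⟩
  | head hadj _ ih =>
    rename_i y u _
    obtain ⟨⟨l, hne, hch, hnd⟩, hini, hter⟩ := ih
    simp only [Dipath.ini, Dipath.ter] at hini hter
    -- If the walk revisits `y`, the detour is cut out.
    by_cases hy : y ∈ l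
    · obtain ⟨l₁, l₂, rfl⟩ := List.append_of_mem hy
      refine ⟨⟨y :: l₂, by simp, (List.isChain_append.1 hch).2.1,
        (List.nodup_append.1 hnd).2.1⟩, rfl, ?_⟩
      rw [← hter]
      simp [Dipath.ter]
    · refine ⟨⟨y :: l, by simp, ?_, List.nodup_cons.2 ⟨hy, hnd⟩⟩, rfl, ?_⟩
      · rw [List.isChain_cons]
        refine ⟨?_, hch⟩
        intro z hz
        rw [List.head?_eq_some_head hne, Option.mem_some_iff] at hz
        rw [← hz, hini]
        exact hadj
      · rw [← hter]
        simp [Dipath.ter, List.getLast_cons hne]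

/-- Either a linkable set can be augmented from `Y`, or there is a set which separates `Y` from
the exits and which the router `m` enters only from inside. -/
theorem IsRouter.augment {D : Dimaze V} {m : V → V} (hm : D.IsRouter m) {J : Set V}
    (hJ : J ⊆ D.free m) (Y : Set V) :
    (∃ y ∈ Y, D.Linkable (insert y J)) ∨
      ∃ U, J ∪ Y ⊆ U ∧ D.free m ∩ U ⊆ J ∧
        ∀ v, v ∉ D.exits → m v ∈ U → v ∈ U ∧ ∀ u, D.Adj v u → u ∈ U := by
  rw [or_iff_not_imp_left]
  intro hno
  have hF : D.free m \ J ⊆ D.free m := sdiff_subset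
  -- A path of `E` from `Y` to an exit is an augmenting path for `m` that leaves `J` free. If there
  -- is none, `U` consists of `J` and everything reachable from `Y`.
  let E : Dimaze V := D.shift m J (D.free m \ J) hF
  refine ⟨J ∪ {u | ∃ y ∈ Y, Relation.ReflTransGen E.Adj y u}, ?_, ?_, ?_⟩
  · exact union_subset_union_right _ fun y hy => ⟨y, hy, .refl⟩
  · rintro b ⟨hb, hbJ | ⟨y, hy, hyb⟩⟩
    · exact hbJ
    · by_contra hbJ
      refine hno ⟨y, hy, ?_⟩
      have hl : E.Linkable {y} := E.linkable_singleton_of_reflTransGen hyb ⟨hb, hbJ⟩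
      obtain ⟨t, ht, hyt, -, hfin⟩ := hl.exists_isRouter
      obtain ⟨n, hn, -, hfree⟩ := hm.exists_comp hF hJ ht (hfin (finite_singleton y))
      refine hn.linkable (insert_subset (hfree (Or.inr (hyt rfl))) ?_)
      exact fun j hj => hfree (Or.inl hj)
  · rintro v hv (h | ⟨y, hy, hyv⟩)
    · exact absurd h (apply_notMem_of_subset_free hJ hv)
    · have key : ∀ u, (u = v ∨ D.Adj v u) →
          u ∈ J ∪ {u | ∃ y ∈ Y, Relation.ReflTransGen E.Adj y u} := by
        intro u hu
        by_cases huJ : u ∈ J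
        · exact Or.inl huJ
        by_cases hum : u = m v
        · exact Or.inr ⟨y, hy, hum ▸ hyv⟩
        · exact Or.inr ⟨y, hy, hyv.tail ⟨v, hv, rfl, hu, hum, huJ⟩⟩
      exact ⟨key v (Or.inl rfl), fun u hu => key u (Or.inr hu)⟩

/-- Outside a finite `m`-invariant set `X` containing the exits, `m` is the identity, so the count
reduces to `X` minus an injective image of `X \ D.exits`. -/
theorem IsRouter.encard_free {D : Dimaze V} {m : V → V} (hm : D.IsRouter m)
    (hB : D.exits.Finite) (hfin : {v | m v ≠ v}.Finite) :
    (D.free m).encard = D.exits.encard := by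
  let X : Set V := D.exits ∪ ({v | m v ≠ v} ∪ m '' {v | m v ≠ v})
  have hX : X.Finite := hB.union (hfin.union (hfin.image m))
  have hmX : ∀ {x}, x ∈ X → m x ∈ X := by
    intro x hx
    by_cases h : m x = x
    · rwa [h]
    · exact Or.inr (Or.inr ⟨x, h, rfl⟩)
  have hXm : ∀ {x}, x ∉ X → m x = x := by
    intro x hx
    by_contra h
    exact hx (Or.inr (Or.inl h))
  have hfree : D.free m = X \ m '' (X \ D.exits) := by
    ext w
    rw [mem_free]
    constructor
    · intro hw
      refine ⟨?_, ?_⟩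
      · by_contra hwX
        exact hw w (fun h => hwX (Or.inl h)) (hXm hwX)
      · rintro ⟨v, hv, rfl⟩
        exact hw v hv.2 rfl
    · rintro ⟨hwX, hw⟩ v hv rfl
      by_cases hvX : v ∈ X
      · exact hw ⟨v, ⟨hvX, hv⟩, rfl⟩
      · rw [hXm hvX] at hwX
        exact hvX hwX
  have h1 : (m '' (X \ D.exits)).encard = (X \ D.exits).encard :=
    (hm.injOn.mono fun x hx => hx.2).encard_image
  have h2 := encard_sdiff_add_encard_of_subset (s := m '' (X \ D.exits)) (t := X)
    (by rintro _ ⟨x, hx, rfl⟩; exact hmX hx.1)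
  have h3 := encard_sdiff_add_encard_of_subset (s := D.exits) (t := X) subset_union_left
  rw [← hfree, h1] at h2
  have hf : (X \ D.exits).encard ≠ ⊤ := by
    rw [encard_ne_top_iff]; exact hX.subset sdiff_subset
  rw [← h3, add_comm (X \ D.exits).encard] at h2
  exact WithTop.add_right_cancel hf h2

/-- The linkability system of a dimaze with finitely many exits is a matroid. -/
theorem exists_isLinkabilityMatroid (D : Dimaze V) (hB : D.exits.Finite) :
    ∃ L : Matroid V, D.IsLinkabilityMatroid L := by
  have haug : ∀ ⦃I J : Set V⦄, D.Linkable I → D.Linkable J → I.encard < J.encard →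
      ∃ e ∈ J, e ∉ I ∧ D.Linkable (insert e I) := by
    intro I J hI hJ hIJ
    have hIfin : I.Finite := encard_lt_top_iff.1 (hIJ.trans_le le_top)
    obtain ⟨m, hm, hIm, -, hmfin⟩ := hI.exists_isRouter
    obtain ⟨k, hk, hJk, -, -⟩ := hJ.exists_isRouter
    rcases hm.augment hIm (J \ I) with ⟨y, hy, hl⟩ | ⟨U, hYU, hUI, hU⟩
    · exact ⟨y, hy.1, hy.2, hl⟩
    exfalso
    rw [union_sdiff_self] at hYU
    -- Following `k` inside `U` and `m` outside replaces `I` by the larger `J` in `D.free m`, which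
    -- already has as many elements as there are exits.
    have hl := (hm.linkable_combine hk hU).subset (A' := J ∪ (D.free m \ I)) (by
      refine union_subset_union (fun x hx => ⟨hYU (Or.inr hx), hJk hx⟩) ?_
      exact fun x hx => ⟨hx.1, fun hxU => hx.2 (hUI ⟨hx.1, hxU⟩)⟩)
    have h1 := hl.encard_le
    have hdis : Disjoint J (D.free m \ I) := by
      rw [Set.disjoint_left]
      exact fun x hx hx' => hx'.2 (hUI ⟨hx'.1, hYU (Or.inr hx)⟩)
    have hFc := hm.encard_free hB (hmfin hIfin)
    have h2 := encard_sdiff_add_encard_of_subset hIm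
    rw [encard_union_eq hdis, ← hFc, ← h2, add_comm] at h1
    have hf : (D.free m \ I).encard ≠ ⊤ := by
      refine ne_top_of_le_ne_top ?_ (encard_le_encard sdiff_subset)
      rw [hFc]; exact encard_ne_top_iff.2 hB
    exact absurd ((ENat.add_le_add_iff_left hf).1 h1) (not_le.2 hIJ)
  refine ⟨(IndepMatroid.ofBddAugment univ D.Linkable D.linkable_empty
    (fun I J hJ hIJ => hJ.subset hIJ) haug ⟨D.exits.ncard, fun I hI => ?_⟩
    (fun I _ => subset_univ I)).matroid, rfl, fun I => Iff.rfl⟩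
  rw [hB.cast_ncard_eq]
  exact hI.encard_le

/-- If `B` is finite and extends the linkable set `S` as much as possible within `Y`, then
"linkability together with `S`" within `Y` is described by a dimaze with exits `B`. -/
theorem exists_dimaze_linkable_iff (D : Dimaze V) {S Y B : Set V} (hSY : Disjoint S Y)
    (hBY : B ⊆ Y) (hB : B.Finite) (hSB : D.Linkable (S ∪ B))
    (hmax : ∀ X ⊆ Y, D.Linkable (S ∪ X) → X.encard ≤ B.encard) :
    ∃ D' : Dimaze V, D'.exits = B ∧ ∀ I ⊆ Y, (D'.Linkable I ↔ D.Linkable (S ∪ I)) := by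
  classical
  obtain ⟨m, hm, hSBm, -, -⟩ := hSB.exists_isRouter
  have hBm : B ⊆ D.free m := subset_union_right.trans hSBm
  have hSm : S ⊆ D.free m := subset_union_left.trans hSBm
  let D' : Dimaze V := D.shift m S B hBm
  have hfinI : ∀ {I : Set V}, I.encard ≤ B.encard → I.Finite := fun h =>
    encard_lt_top_iff.1 (h.trans_lt hB.encard_lt_top)
  refine ⟨D', rfl, fun I hIY => ⟨fun hI => ?_, fun hI => ?_⟩⟩
  · obtain ⟨t, ht, hIt, -, hfin⟩ := hI.exists_isRouter
    obtain ⟨n, hn, -, hfree⟩ := hm.exists_comp hBm hSm ht (hfin (hfinI hI.encard_le))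
    exact hn.linkable ((union_subset_union_right S hIt).trans hfree)
  · obtain ⟨k, hk, hSIk, -, -⟩ := hI.exists_isRouter
    have hIfin : I.Finite := hfinI (hmax I hIY hI)
    obtain ⟨J, ⟨hJI, hJ⟩, hJmax⟩ := (hIfin.finite_subsets.subset
      (t := {J | J ⊆ I ∧ D'.Linkable J}) (fun J hJ => hJ.1)).exists_maximal
      ⟨∅, empty_subset I, D'.linkable_empty⟩
    obtain rfl | hss := hJI.eq_or_ssubset
    · exact hJ
    exfalso
    have hJfin := hIfin.subset hJI
    obtain ⟨t, ht, hJt, htJ, htfin⟩ := hJ.exists_isRouter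
    have htfin := htfin hJfin
    rcases ht.augment hJt (I \ J) with ⟨y, hy, hl⟩ | ⟨U, hYU, hUJ, hU⟩
    · exact hy.2 (hJmax ⟨insert_subset hy.1 hJI, hl⟩ (subset_insert y J) (mem_insert y J))
    rw [union_sdiff_self, union_eq_self_of_subset_left hJI] at hYU
    -- `t'` halts `t` wherever it would move into `U`. The halted vertices already lie in `U`, so
    -- injectivity survives.
    let t' : V → V := fun x => if t x ∈ U then x else t x
    have ht'U : ∀ {x}, t x ∈ U → t' x = x := fun h => if_pos h
    have ht'n : ∀ {x}, t x ∉ U → t' x = t x := fun h => if_neg h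
    have ht'fin : {x | t' x ≠ x}.Finite := by
      refine htfin.subset fun x hx h => hx ?_
      by_cases h1 : t x ∈ U
      · exact ht'U h1
      · exact (ht'n h1).trans h
    have ht' : D'.IsRouter t' := by
      refine ⟨?_, ?_, finiteOrbits_of_finite_support ht'fin⟩
      · intro x hx x' hx' h
        by_cases h1 : t x ∈ U <;> by_cases h2 : t x' ∈ U
        · rwa [ht'U h1, ht'U h2] at h
        · rw [ht'U h1, ht'n h2] at h
          exact absurd (h ▸ (hU x hx h1).1) h2
        · rw [ht'n h1, ht'U h2] at h
          exact absurd (h ▸ (hU x' hx' h2).1) h1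
        · rw [ht'n h1, ht'n h2] at h
          exact ht.injOn hx hx' h
      · intro x
        by_cases h1 : t x ∈ U
        · exact Or.inl (ht'U h1)
        · rw [ht'n h1]; exact ht.adj x
    obtain ⟨n, hn, hnt, hfree⟩ := hm.exists_comp hBm hSm ht' ht'fin
    have hnU : ∀ v, v ∉ D.exits → n v ∈ U ∪ S →
        v ∈ U ∪ S ∧ ∀ u, D.Adj v u → u ∈ U ∪ S := by
      intro v hv h
      have hmvB : m v ∉ D'.exits := apply_notMem_of_subset_free hBm hv
      have h1 : t' (m v) ∈ U := by
        rw [← hnt v hv]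
        exact h.resolve_right
          (apply_notMem_of_subset_free (subset_union_left.trans hfree) hv)
      have h2 : t (m v) ∈ U := by
        by_contra h2
        exact h2 (ht'n h2 ▸ h1)
      obtain ⟨h3, h4⟩ := hU _ hmvB h2
      have key : ∀ u, (u = v ∨ D.Adj v u) → u ∈ U ∪ S := by
        intro u hu
        by_cases huS : u ∈ S
        · exact Or.inr huS
        by_cases hum : u = m v
        · exact Or.inl (hum ▸ h3)
        · exact Or.inl (h4 u ⟨v, hv, rfl, hu, hum, huS⟩)
      exact ⟨key v (Or.inl rfl), fun u hu => key u (Or.inr hu)⟩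
    have hFY : D'.free t ⊆ Y := htJ.trans (union_subset (hJI.trans hIY) hBY)
    -- In `D`, `U ∪ S` is entered by `n` only from inside, so `k` can take over there. This
    -- exchanges `J` for the larger `I` in `D'.free t`, which has size `B.encard`, contradicting
    -- `hmax`.
    have hl := (hn.linkable_combine hk hnU).subset (A' := S ∪ (I ∪ (D'.free t \ J))) (by
      rw [← union_assoc]
      refine union_subset_union (fun x hx => ⟨?_, hSIk hx⟩) fun x hx => ?_
      · exact hx.elim Or.inr fun h => Or.inl (hYU h)
      · have hxU : x ∉ U := fun hxU => hx.2 (hUJ ⟨hx.1, hxU⟩)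
        refine ⟨hfree (Or.inr ?_), fun h => h.elim hxU
          fun hxS => Set.disjoint_left.1 hSY hxS (hFY hx.1)⟩
        rw [mem_free]
        intro v hv h
        by_cases h1 : t v ∈ U
        · rw [ht'U h1] at h
          exact hxU (h ▸ (hU v hv h1).1)
        · rw [ht'n h1] at h
          exact mem_free.1 hx.1 v hv h)
    have h1 := hmax _ (union_subset hIY (sdiff_subset.trans hFY)) hl
    have hdis : Disjoint I (D'.free t \ J) := by
      rw [Set.disjoint_left]
      exact fun x hx hx' => hx'.2 (hUJ ⟨hx'.1, hYU hx⟩)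
    have hFc : (D'.free t).encard = B.encard := ht.encard_free hB htfin
    have h2 := encard_sdiff_add_encard_of_subset hJt
    rw [encard_union_eq hdis, ← hFc, ← h2, add_comm] at h1
    have hf : (D'.free t \ J).encard ≠ ⊤ := by
      refine ne_top_of_le_ne_top ?_ (encard_le_encard sdiff_subset)
      rw [hFc]; exact encard_ne_top_iff.2 hB
    exact absurd ((ENat.add_le_add_iff_left hf).1 h1) (not_le.2 (hJfin.encard_lt_encard hss))

end Dimaze

/-! ### Gammoids as embedded linkability systems, and their minors. -/

theorem IsGammoid.exists_injective {α : Type u} {M : Matroid α} (hM : IsGammoid.{u, v} M) :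
    ∃ (V : Type v) (D : Dimaze V) (f : M.E → V), Function.Injective f ∧
      ∀ I : Set M.E, M.Indep (Subtype.val '' I) ↔ D.Linkable (f '' I) := by
  obtain ⟨β, N, ⟨V, D, L, hL, e₂, h₂⟩, X, hX, e₁, h₁⟩ := hM
  let g : M.E → N.E := fun x => ⟨e₁ x, hX (e₁ x).2⟩
  refine ⟨V, D, fun x => e₂ (g x), ?_, fun I => ?_⟩
  · intro x y hxy
    have := congrArg Subtype.val (e₂.injective (Subtype.ext hxy))
    exact e₁.injective (Subtype.ext this)
  · have himg : (Subtype.val '' (e₁ '' I) : Set β) = Subtype.val '' (g '' I) := by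
      simp only [image_image, g]
    rw [h₁ I, himg, Matroid.restrict_indep_iff, h₂ (g '' I), hL.2, and_iff_left]
    · simp only [image_image]
    · rintro _ ⟨_, ⟨x, -, rfl⟩, rfl⟩
      exact (e₁ x).2

theorem isGammoid_of_injective {α : Type u} {M : Matroid α} {V : Type v} {D : Dimaze V}
    {L : Matroid V} (hL : D.IsLinkabilityMatroid L) {f : M.E → V} (hf : Function.Injective f)
    (h : ∀ I : Set M.E, M.Indep (Subtype.val '' I) ↔ D.Linkable (f '' I)) :
    IsGammoid.{u, v} M := by
  refine ⟨V, L, ⟨V, D, L, hL, Equiv.refl _, fun I => by simp⟩, range f, ?_,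
    Equiv.ofInjective f hf, fun I => ?_⟩
  · rw [hL.1]; exact subset_univ _
  · have himg : (Subtype.val '' (Equiv.ofInjective f hf '' I) : Set V) = f '' I := by
      simp only [image_image, Equiv.ofInjective_apply]
    rw [h I]
    refine Iff.trans ?_ (Matroid.restrict_indep_iff (M := L)).symm
    refine Iff.trans ?_ (and_iff_left ?_).symm
    · rw [hL.2]
      exact iff_of_eq (congrArg D.Linkable himg.symm)
    · exact himg.trans_subset (image_subset_range f I)

/-- Minors of finite rank of gammoids are gammoids. -/
theorem IsGammoid.of_isMinor {α : Type u} {M N : Matroid α} (hM : IsGammoid.{u, v} M)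
    (hN : N.IsMinor M) (hfin : N.RankFinite) : IsGammoid.{u, v} N := by
  obtain ⟨V, D, f, hf, hfI⟩ := hM.exists_injective
  have hNM : N.E ⊆ M.E := hN.subset
  obtain ⟨C, R, rfl⟩ := hN
  set N := (M.contract C).delete R with hNdef
  -- `S` may be infinite; only the rank left after contracting it has to be finite.
  obtain ⟨S, hS⟩ := M.exists_isBasis' C
  have hSE : S ⊆ M.E := hS.indep.subset_ground
  have hNC : Disjoint N.E C := Set.disjoint_left.2 fun x hx hxC => hx.1.2 hxC
  have hindep : ∀ I ⊆ N.E, (N.Indep I ↔ M.Indep (S ∪ I)) := by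
    intro I hI
    rw [hNdef, Matroid.delete_indep_iff, hS.contract_indep_iff, union_comm,
      and_iff_left (hNC.symm.mono_right hI), and_iff_left]
    exact Set.disjoint_left.2 fun x hx hxR => (hI hx).2 hxR
  let g : N.E → V := fun x => f ⟨x, hNM x.2⟩
  have hg : Function.Injective g := fun x y hxy =>
    Subtype.ext (Subtype.mk.inj (hf hxy))
  let S' : Set V := f '' (Subtype.val ⁻¹' S)
  have hlink : ∀ I : Set N.E, N.Indep (Subtype.val '' I) ↔ D.Linkable (S' ∪ g '' I) := by
    intro I
    have h1 : S ∪ Subtype.val '' I =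
        Subtype.val '' ((Subtype.val ⁻¹' S : Set M.E) ∪
          (fun x : N.E => (⟨x, hNM x.2⟩ : M.E)) '' I) := by
      rw [image_union, Subtype.image_preimage_coe, inter_eq_right.2 hSE, image_image]
    rw [hindep _ (by rintro _ ⟨x, -, rfl⟩; exact x.2), h1, hfI, image_union, image_image]
  have hdis : Disjoint S' (range g) := by
    rw [Set.disjoint_left]
    rintro _ ⟨s, hs, rfl⟩ ⟨y, hy⟩
    have h1 := congrArg Subtype.val (hf hy)
    exact Set.disjoint_left.1 hNC y.2 (hS.subset (h1 ▸ hs))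
  obtain ⟨B, hB⟩ := N.exists_isBase
  have hBE : B ⊆ N.E := hB.subset_ground
  have himg : (Subtype.val '' (Subtype.val ⁻¹' B : Set N.E) : Set α) = B := by
    rw [Subtype.image_preimage_coe, inter_eq_right.2 hBE]
  have hcard : ∀ I : Set N.E, (g '' I).encard = (Subtype.val '' I : Set α).encard := fun I => by
    rw [hg.encard_image, Subtype.val_injective.encard_image]
  have hB'card := hcard (Subtype.val ⁻¹' B)
  rw [himg] at hB'card
  obtain ⟨D', hD', hiff⟩ := D.exists_dimaze_linkable_iff (B := g '' (Subtype.val ⁻¹' B)) hdis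
    (image_subset_range _ _)
    (encard_lt_top_iff.1 (hB'card ▸ hB.finite.encard_lt_top))
    ((hlink _).1 (by rw [himg]; exact hB.indep))
    (by
      intro X hX hl
      obtain ⟨I, rfl⟩ := subset_range_iff_exists_image_eq.1 hX
      rw [hB'card, hcard, hB.encard_eq_eRank]
      exact ((hlink I).2 hl).encard_le_eRank)
  obtain ⟨L, hL⟩ := D'.exists_isLinkabilityMatroid
    (hD' ▸ encard_lt_top_iff.1 (hB'card ▸ hB.finite.encard_lt_top))
  exact isGammoid_of_injective hL hg fun I =>
    (hlink I).trans (hiff _ (image_subset_range _ _)).symm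

end InfGammoid

theorem theorem2p12 {α : Type u} (M N : Matroid α) (hM : InfGammoid.IsGammoid.{u, v} M)
    (hN : N.IsMinor M) (hfin : N.RankFinite) : InfGammoid.IsGammoid.{u, v} N :=
  hM.of_isMinor hN hfin
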